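/- Let $d\ge 5$ be an integer and let $a_1,\dots,a_d,b_1,\dots,b_d\in\mathbb{C}$ satisfy $$\sum_{i=1}^d\left(|a_i|^2+|b_i|^2\right)=\frac1d .$$ Let $P_A,P_B$ be $d\times d$ permutation matrices all of whose diagonal entries are zero, and put $A=\operatorname{diag}(a_1,\dots,a_d)\,P_A$, $B=\operatorname{diag}(b_1,\dots,b_d)\,P_B$ and $$X=A\otimes I_d+I_d\otimes B\in\mathbb{C}^{d^2\times d^2}.$$ Let $\sigma_1\ge\sigma_2\ge\dots\ge\sigma_{d^2}$ be the singular values of $X$, counted with multiplicity. Then $$\sigma_1^2+\sigma_2^2\le\frac12 .$$ -/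

import Mathlib

open scoped Kronecker

/-- The Kronecker sum `A ⊗ I + I ⊗ B` of two square complex matrices. -/
def kroneckerSum {m n : Type*} [DecidableEq m] [DecidableEq n]
    (A : Matrix m m ℂ) (B : Matrix n n ℂ) : Matrix (m × n) (m × n) ℂ :=
  A ⊗ₖ (1 : Matrix n n ℂ) + (1 : Matrix m m ℂ) ⊗ₖ B

/-- The singular values of a square complex matrix in descending order, repeated according to
multiplicity and indexed from `0`: those of the operator that the matrix defines on the Hilbert
space `ℂⁿ`. -/
noncomputable def matrixSingularValue {n : Type*} [Fintype n] [DecidableEq n]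
    (X : Matrix n n ℂ) (k : ℕ) : ℝ :=
  (Matrix.toEuclideanLin X).singularValues k

/-- `P` is a permutation matrix all of whose diagonal entries are zero. -/
def IsZeroDiagPermMatrix {n : Type*} [DecidableEq n] (P : Matrix n n ℂ) : Prop :=
  (∃ σ : Equiv.Perm n, P = σ.permMatrix ℂ) ∧ ∀ i, P i i = 0

/-! Already `‖X‖² ≤ 5/(4d) ≤ 1/4`, so each of the two terms is at most `1/4`. Expanding `‖X u‖²` and
splitting cross terms by AM-GM leaves a weighted sum of `|u (k, l)|²`. Each weight involves two
entries of `a` and two of `b`, at distinct indices because the permutations have no fixed points, so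
it is at most `5/4` of the total mass. -/

/-- Every singular value of `X` is at most `C` in square as soon as `‖X u‖² ≤ C ‖u‖²` for
all `u`. -/
theorem sq_matrixSingularValue_le {n : Type*} [Fintype n] [DecidableEq n]
    (X : Matrix n n ℂ) {C : ℝ} (hC : 0 ≤ C)
    (h : ∀ u : n → ℂ, ∑ i, ‖(X.mulVec u) i‖ ^ 2 ≤ C * ∑ i, ‖u i‖ ^ 2) (k : ℕ) :
    matrixSingularValue X k ^ 2 ≤ C := by
  unfold matrixSingularValue
  set T := Matrix.toEuclideanLin X with hT
  rcases lt_or_ge k (Module.finrank ℂ (EuclideanSpace ℂ n)) with hk | hk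
  · obtain ⟨v, hv⟩ :=
      (T.hasEigenvalue_adjoint_comp_self_sq_singularValues hk).exists_hasEigenvector
    have hv0 : 0 < ‖v‖ ^ 2 := by
      have := norm_pos_iff.mpr hv.2
      positivity
    have hTv : ‖T v‖ ^ 2 = T.singularValues k ^ 2 * ‖v‖ ^ 2 := by
      have h1 : inner ℂ v ((LinearMap.adjoint T ∘ₗ T) v) = ((‖T v‖ ^ 2 : ℝ) : ℂ) := by
        rw [LinearMap.comp_apply, LinearMap.adjoint_inner_right, inner_self_eq_norm_sq_to_K]
        push_cast
        rfl
      rw [hv.apply_eq_smul, inner_smul_right, inner_self_eq_norm_sq_to_K] at h1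
      exact Complex.ofReal_injective (by rw [← h1]; push_cast; rfl)
    have hle : ‖T v‖ ^ 2 ≤ C * ‖v‖ ^ 2 := by
      have := h v.ofLp
      rw [EuclideanSpace.norm_sq_eq, EuclideanSpace.norm_sq_eq]
      simpa [hT, Matrix.toLpLin_apply] using this
    rw [hTv] at hle
    exact le_of_mul_le_mul_right hle hv0
  -- Past the dimension, singular values are `0` by convention.
  · rw [T.singularValues_of_finrank_le hk]
    simpa using hC

theorem kroneckerSum_monomial_mulVec {m n : Type*} [Fintype m] [Fintype n] [DecidableEq m]
    [DecidableEq n] (a : m → ℂ) (b : n → ℂ) (σ : Equiv.Perm m) (τ : Equiv.Perm n)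
    (u : m × n → ℂ) (i : m) (j : n) :
    (kroneckerSum (Matrix.diagonal a * σ.permMatrix ℂ)
      (Matrix.diagonal b * τ.permMatrix ℂ)).mulVec u (i, j)
      = a i * u (σ i, j) + b j * u (i, τ j) := by
  have entry (x : m) (y : n) : kroneckerSum (Matrix.diagonal a * σ.permMatrix ℂ)
      (Matrix.diagonal b * τ.permMatrix ℂ) (i, j) (x, y)
      = (if σ i = x then if j = y then a i else 0 else 0)
        + (if i = x then if τ j = y then b j else 0 else 0) := by
    rw [kroneckerSum, Matrix.add_apply, Matrix.kroneckerMap_apply, Matrix.kroneckerMap_apply,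
      Matrix.diagonal_mul, Matrix.diagonal_mul, Matrix.one_apply, Matrix.one_apply]
    simp only [Equiv.Perm.permMatrix, PEquiv.toMatrix_apply, Equiv.toPEquiv_apply,
      Option.mem_def, Option.some.injEq]
    split_ifs <;> simp
  simp [Matrix.mulVec, dotProduct, Fintype.sum_prod_type, entry, add_mul, ite_mul,
    Finset.sum_add_distrib]

theorem norm_sq_add_norm_sq_perm_le {n : Type*} [Fintype n] [DecidableEq n] (c : n → ℂ)
    (ρ : Equiv.Perm n) (hρ : ∀ i, ρ i ≠ i) (k : n) :
    ‖c k‖ ^ 2 + ‖c (ρ k)‖ ^ 2 ≤ ∑ i, ‖c i‖ ^ 2 := by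
  rw [← Finset.sum_pair (f := fun i => ‖c i‖ ^ 2) (hρ k).symm]
  exact Finset.sum_le_sum_of_subset_of_nonneg (Finset.subset_univ _)
    fun _ _ _ => by positivity

/-- If `σ` and `τ` have no fixed points, the Kronecker sum of the monomial matrices
`diag(a) P_σ` and `diag(b) P_τ` has squared operator norm at most `5/4 ∑ (|aᵢ|² + |bᵢ|²)`. -/
theorem sum_norm_sq_kroneckerSum_monomial_le {m n : Type*} [Fintype m] [Fintype n]
    [DecidableEq m] [DecidableEq n] (a : m → ℂ) (b : n → ℂ) (σ : Equiv.Perm m)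
    (τ : Equiv.Perm n) (hσ : ∀ i, σ i ≠ i) (hτ : ∀ j, τ j ≠ j) (u : m × n → ℂ) :
    ∑ x, ‖(kroneckerSum (Matrix.diagonal a * σ.permMatrix ℂ)
      (Matrix.diagonal b * τ.permMatrix ℂ)).mulVec u x‖ ^ 2
      ≤ 5 / 4 * (∑ i, ‖a i‖ ^ 2 + ∑ j, ‖b j‖ ^ 2) * ∑ x, ‖u x‖ ^ 2 := by
  calc
    _ ≤ ∑ i, ∑ j, ((‖a i‖ ^ 2 + ‖a i‖ * ‖b j‖) * ‖u (σ i, j)‖ ^ 2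
          + (‖b j‖ ^ 2 + ‖a i‖ * ‖b j‖) * ‖u (i, τ j)‖ ^ 2) := by
      rw [Fintype.sum_prod_type]
      refine Finset.sum_le_sum fun i _ => Finset.sum_le_sum fun j _ => ?_
      rw [kroneckerSum_monomial_mulVec]
      have h1 := norm_add_le (a i * u (σ i, j)) (b j * u (i, τ j))
      rw [norm_mul, norm_mul] at h1
      have h2 := pow_le_pow_left₀ (norm_nonneg _) h1 2
      have h3 : 0 ≤ ‖a i‖ * ‖b j‖ := by positivity
      -- The cross term is split by `2xy ≤ x² + y²`, with weight `‖a i‖ * ‖b j‖`.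
      nlinarith [mul_nonneg h3 (sq_nonneg (‖u (σ i, j)‖ - ‖u (i, τ j)‖))]
    -- Reindexing by `σ` and `τ` collects the coefficient of each `‖u (k, l)‖ ^ 2`.
    _ = ∑ k, ∑ l, (‖a (σ.symm k)‖ ^ 2 + ‖a (σ.symm k)‖ * ‖b l‖
          + (‖b (τ.symm l)‖ ^ 2 + ‖a k‖ * ‖b (τ.symm l)‖)) * ‖u (k, l)‖ ^ 2 := by
      simp only [add_mul _ _ (‖u _‖ ^ 2), Finset.sum_add_distrib]
      congr 1
      · congr 1
        · exact Fintype.sum_equiv σ _ _ (by simp)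
        · exact Fintype.sum_equiv σ _ _ (by simp)
      · congr 1
        · refine Finset.sum_congr rfl fun i _ => ?_
          exact Fintype.sum_equiv τ _ _ (by simp)
        · refine Finset.sum_congr rfl fun i _ => ?_
          exact Fintype.sum_equiv τ _ _ (by simp)
    _ ≤ _ := by
      rw [Fintype.sum_prod_type, Finset.mul_sum]
      refine Finset.sum_le_sum fun k _ => ?_
      rw [Finset.mul_sum]
      refine Finset.sum_le_sum fun l _ => mul_le_mul_of_nonneg_right ?_ (by positivity)
      have h1 := norm_sq_add_norm_sq_perm_le a σ hσ (σ.symm k)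
      have h2 := norm_sq_add_norm_sq_perm_le b τ hτ (τ.symm l)
      rw [Equiv.apply_symm_apply] at h1 h2
      -- With `p, q = ‖a (σ.symm k)‖, ‖a k‖` and `r, s = ‖b (τ.symm l)‖, ‖b l‖`, the source of `5/4`
      -- is `ps ≤ p²/4 + s²` and `qr ≤ r²/4 + q²`.
      nlinarith [sq_nonneg (‖a (σ.symm k)‖ / 2 - ‖b l‖), sq_nonneg (‖b (τ.symm l)‖ / 2 - ‖a k‖),
        sq_nonneg ‖a k‖, sq_nonneg ‖b l‖]

theorem IsZeroDiagPermMatrix.exists_perm {n : Type*} [DecidableEq n] {P : Matrix n n ℂ}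
    (hP : IsZeroDiagPermMatrix P) : ∃ σ : Equiv.Perm n, P = σ.permMatrix ℂ ∧ ∀ i, σ i ≠ i := by
  obtain ⟨⟨σ, rfl⟩, h0⟩ := hP
  refine ⟨σ, rfl, fun i hi => ?_⟩
  simpa [Equiv.Perm.permMatrix, PEquiv.toMatrix_apply, hi] using h0 i

theorem mainTheorem5 (d : ℕ) (hd : 5 ≤ d) (a b : Fin d → ℂ)
    (A B P_A P_B : Matrix (Fin d) (Fin d) ℂ)
    (hP_A : IsZeroDiagPermMatrix P_A) (hP_B : IsZeroDiagPermMatrix P_B)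
    (hA : A = Matrix.diagonal a * P_A) (hB : B = Matrix.diagonal b * P_B)
    (hnorm : ∑ i, (‖a i‖ ^ 2 + ‖b i‖ ^ 2) = 1 / (d : ℝ)) :
    matrixSingularValue (kroneckerSum A B) 0 ^ 2
      + matrixSingularValue (kroneckerSum A B) 1 ^ 2 ≤ 1 / 2 := by
  obtain ⟨σ, rfl, hσ⟩ := hP_A.exists_perm
  obtain ⟨τ, rfl, hτ⟩ := hP_B.exists_perm
  subst hA hB
  have hd' : (1 : ℝ) / d ≤ 1 / 5 :=
    one_div_le_one_div_of_le (by norm_num) (by exact_mod_cast hd)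
  have key := sq_matrixSingularValue_le _ (by positivity)
    (sum_norm_sq_kroneckerSum_monomial_le a b σ τ hσ hτ)
  rw [← Finset.sum_add_distrib, hnorm] at key
  -- `d ≥ 5` enters as `5/4 * 1/d ≤ 1/4`.
  linarith [key 0, key 1]
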